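/- Let $(N,h)$ be a smooth Riemannian manifold of dimension $n\ge 1$ with Levi-Civita connection $\nabla$ and Riemann curvature tensor $R$, and let $\gamma:\mathbb{R}\to N$ be a (complete) geodesic parametrized by arc length. Suppose that $N$ is locally symmetric along $\gamma$, i.e. $\nabla_{\dot\gamma}\nabla^jR=0$ at every point of $\gamma$ for all $j=0,1,2,\dots$. Let $e_1=\dot\gamma$ and let $e_2,\dots,e_n$ be parallel vector fields along $\gamma$ such that $(e_1,\dots,e_n)$ is orthonormal at $\gamma(0)$ (hence everywhere along $\gamma$). Let $(x^1,\dots,x^n)$ be the geodesic normal (Fermi) coordinates around $\gamma$ given by the parametrization $$\sigma(x^1,x^2,\dots,x^n)=\exp_{\gamma(x^1)}\Big(\sum_{j=2}^n x^je_j(x^1)\Big),$$ considered on an open neighborhood $U\subset\mathbb{R}^n$ of the axis $\mathbb{R}\times\{0\}$ which is star-shaped in the transversal variables $(x^2,\dots,x^n)$ and on which $\sigma$ is defined and is a local diffeomorphism. Let $g_{ij}=h(\partial_i\sigma,\partial_j\sigma)$ be the components of the metric on $U$, let $\Gamma^k_{ij}$ be the Christoffel symbols of $g$, and let $R^i_{jkl}$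 be the components of the curvature, with $\nabla_j\nabla_k\partial_l-\nabla_k\nabla_j\partial_l=R^i_{jkl}\partial_i$. Then $\Gamma^k_{ij}$ and $R^i_{jkl}$ are smooth on $U$, and for every multi-index $I=(i_1,\dots,i_m)\in\{1,\dots,n\}^m$, $m\ge 0$, with $\partial^I=\partial_{i_1}\cdots\partial_{i_m}$, and for all indices $i,j,k,l\in\{1,\dots,n\}$, $$\partial_1\partial^I\Gamma^k_{ij}(x^1,0,\dots,0)=0,\qquad \partial_1\partial^IR^i_{jkl}(x^1,0,\dots,0)=0\qquad\text{for all }x^1\in\mathbb{R}.$$ Hence all Taylor coefficients of the Christoffel symbols and of the curvature components along $\gamma$ are constant: $\partial^I\Gamma^k_{ij}(x^1,0,\dots,0)$ and $\partial^IR^i_{jkl}(x^1,0,\dots,0)$ do not depend on $x^1$. -/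

import Mathlib

open scoped Manifold ContDiff

noncomputable section

namespace FermiCoord

/-- The coordinate space `ℝ^{d+1}`. The index `0` plays the role of the tangential direction
(`x^1` in classical notation), the indices `j.succ` are the transversal directions. -/
abbrev Coord (d : ℕ) : Type := EuclideanSpace ℝ (Fin (d + 1))

/-- The `i`-th standard basis vector of the coordinate space. -/
def basisVec {d : ℕ} (i : Fin (d + 1)) : Coord d := EuclideanSpace.single i (1 : ℝ)

/-- The partial derivative `∂_i f`. -/
def pd {d : ℕ} (i : Fin (d + 1)) (f : Coord d → ℝ) (x : Coord d) : ℝ :=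
  fderiv ℝ f x (basisVec i)

/-- The iterated partial derivative `∂^I f = ∂_{i_1} ∂_{i_2} ⋯ ∂_{i_m} f` for
`I = (i_1, …, i_m)`. -/
def pdIter {d : ℕ} : List (Fin (d + 1)) → (Coord d → ℝ) → Coord d → ℝ
  | [], f => f
  | i :: I, f => pd i (pdIter I f)

/-! ### Local tensor calculus

Here `g` is a field of matrices of metric components `g_{ij}` in some coordinates. -/

/-- Christoffel symbols:
`Γ^k_{ij} = 1/2 * g^{kl} (∂_i g_{jl} + ∂_j g_{il} - ∂_l g_{ij})`. -/
def christoffel {d : ℕ} (g : Coord d → Matrix (Fin (d + 1)) (Fin (d + 1)) ℝ)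
    (k i j : Fin (d + 1)) (x : Coord d) : ℝ :=
  (1 / 2 : ℝ) * ∑ l, (g x)⁻¹ k l *
    (pd i (fun y => g y j l) x + pd j (fun y => g y i l) x - pd l (fun y => g y i j) x)

/-- Components of the Riemann curvature tensor, with the convention
`∇_j ∇_k ∂_l - ∇_k ∇_j ∂_l = R^i_{jkl} ∂_i`. -/
def riemann {d : ℕ} (g : Coord d → Matrix (Fin (d + 1)) (Fin (d + 1)) ℝ)
    (i j k l : Fin (d + 1)) (x : Coord d) : ℝ :=
  pd j (christoffel g i k l) x - pd k (christoffel g i j l) x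
    + ∑ m, (christoffel g i j m x * christoffel g m k l x
        - christoffel g i k m x * christoffel g m j l x)

/-- Components `T^i_{J_1 … J_m}` of a tensor field of type `(1, m)` in some coordinates. -/
abbrev TensorComp (d m : ℕ) : Type :=
  Fin (d + 1) → (Fin m → Fin (d + 1)) → Coord d → ℝ

/-- Covariant derivative of a tensor field of type `(1, m)`; the index of differentiation is the
first lower index of the result:
`(∇_k T)^i_J = ∂_k T^i_J + Γ^i_{ka} T^a_J - ∑_p Γ^a_{k J_p} T^i_{J_1 … a … J_m}`. -/
def covDeriv {d m : ℕ} (g : Coord d → Matrix (Fin (d + 1)) (Fin (d + 1)) ℝ)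
    (T : TensorComp d m) : TensorComp d (m + 1) := fun i J x =>
  pd (J 0) (T i (Fin.tail J)) x
    + ∑ a, christoffel g i (J 0) a x * T a (Fin.tail J) x
    - ∑ p : Fin m, ∑ a, christoffel g a (J 0) (Fin.tail J p) x *
        T i (Function.update (Fin.tail J) p a) x

/-- Components of `∇^j R`, the `j`-th iterated covariant derivative of the curvature tensor. -/
def iterCovRiemann {d : ℕ} (g : Coord d → Matrix (Fin (d + 1)) (Fin (d + 1)) ℝ) :
    (j : ℕ) → TensorComp d (3 + j)
  | 0 => fun i J x => riemann g i (J 0) (J 1) (J 2) x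
  | j + 1 => covDeriv g (iterCovRiemann g j)

/-! ### Riemannian manifolds -/

section Manifold

variable {d : ℕ} {N : Type*} [TopologicalSpace N] [ChartedSpace (Coord d) N]
  [IsManifold (𝓡 (d + 1)) ∞ N]

/-- A smooth Riemannian metric on the `(d+1)`-dimensional manifold `N`. -/
abbrev Metric (d : ℕ) (N : Type*) [TopologicalSpace N] [ChartedSpace (Coord d) N]
    [IsManifold (𝓡 (d + 1)) ∞ N] : Type _ :=
  Bundle.ContMDiffRiemannianMetric (𝓡 (d + 1)) ∞ (Coord d)
    (fun p : N => TangentSpace (𝓡 (d + 1)) p)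

/-- The metric components `g_{ij} = h(∂_i ψ, ∂_j ψ)` in a local parametrization `ψ` of `N`. -/
def metricComp (h : Metric d N) (ψ : Coord d → N) (x : Coord d) :
    Matrix (Fin (d + 1)) (Fin (d + 1)) ℝ := Matrix.of fun i j =>
  h.inner (ψ x) (mfderiv (𝓡 (d + 1)) (𝓡 (d + 1)) ψ x (basisVec i))
    (mfderiv (𝓡 (d + 1)) (𝓡 (d + 1)) ψ x (basisVec j))

/-- The velocity vector of a curve. -/
def velocity (c : ℝ → N) (t : ℝ) : TangentSpace (𝓡 (d + 1)) (c t) :=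
  mfderiv 𝓘(ℝ, ℝ) (𝓡 (d + 1)) c t (1 : ℝ)

/-- `c` is a geodesic on the open set `S` of parameters: it is smooth there, and it solves the
geodesic equation `u'' ^ i + Γ^i_{jk} u' ^ j u' ^ k = 0` in every chart of `N`. -/
def IsGeodesicOn (h : Metric d N) (c : ℝ → N) (S : Set ℝ) : Prop :=
  ContMDiffOn 𝓘(ℝ, ℝ) (𝓡 (d + 1)) ∞ c S ∧
  ∀ φ ∈ IsManifold.maximalAtlas (𝓡 (d + 1)) ∞ N, ∀ t ∈ S, c t ∈ φ.source → ∀ i,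
    deriv (deriv fun s => φ (c s) i) t
      + ∑ j, ∑ k, christoffel (metricComp h φ.symm) i j k (φ (c t))
          * deriv (fun s => φ (c s) j) t * deriv (fun s => φ (c s) k) t = 0

/-- The vector field `V` along the curve `c : ℝ → N` is parallel:
`(V^i)' + Γ^i_{jk} u' ^ j V^k = 0` in every chart of `N`. -/
def IsParallelAlong (h : Metric d N) (c : ℝ → N)
    (V : (t : ℝ) → TangentSpace (𝓡 (d + 1)) (c t)) : Prop :=
  ∀ φ ∈ IsManifold.maximalAtlas (𝓡 (d + 1)) ∞ N, ∀ t, c t ∈ φ.source →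
    let v : ℝ → Coord d := fun s => mfderiv (𝓡 (d + 1)) (𝓡 (d + 1)) φ (c s) (V s)
    ∀ i, HasDerivAt (fun s => v s i)
      (-∑ j, ∑ k, christoffel (metricComp h φ.symm) i j k (φ (c t))
          * deriv (fun s => φ (c s) j) t * v t k) t

/-- `N` is locally symmetric along `γ`: `∇_{γ'} ∇^j R = 0` at every point of `γ`, for all
`j = 0, 1, 2, …`; the vanishing of this tensor is expressed by its components in the charts. -/
def IsLocallySymmetricAlong (h : Metric d N) (γ : ℝ → N) : Prop :=
  ∀ j : ℕ, ∀ t : ℝ, ∀ φ ∈ IsManifold.maximalAtlas (𝓡 (d + 1)) ∞ N, γ t ∈ φ.source →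
    ∀ (i : Fin (d + 1)) (J : Fin (3 + j) → Fin (d + 1)),
      ∑ k, deriv (fun s => φ (γ s) k) t *
        covDeriv (metricComp h φ.symm) (iterCovRiemann (metricComp h φ.symm) j) i
          (Fin.cons k J) (φ (γ t)) = 0

/-- A frame along `γ` consisting of `e_0 = γ'` and of vector fields `e_1, …, e_d` obtained by
parallel transport, which is orthonormal at `γ(0)`. (In particular `γ` has unit speed there.) -/
structure IsFermiFrame (h : Metric d N) (γ : ℝ → N)
    (e : Fin (d + 1) → (t : ℝ) → TangentSpace (𝓡 (d + 1)) (γ t)) : Prop where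
  tangent : ∀ t, e 0 t = velocity γ t
  parallel : ∀ j : Fin d, IsParallelAlong h γ (e j.succ)
  orthonormal : ∀ i j, h.inner (γ 0) (e i 0) (e j 0) = if i = j then 1 else 0

/-- The point `(t, 0, …, 0)` of the axis, which corresponds to `γ(t)`. -/
def axis {d : ℕ} (t : ℝ) : Coord d := EuclideanSpace.single 0 t

/-- The point `(0, y)` of the coordinate space. -/
def transversal {d : ℕ} (y : Fin d → ℝ) : Coord d :=
  WithLp.toLp 2 (Fin.cons (0 : ℝ) y : Fin (d + 1) → ℝ)

/-- Geodesic normal (Fermi) coordinates around `γ`, given by the parametrization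
`σ(t, y) = exp_{γ(t)} (∑ j, y_j e_j(t))` of a neighborhood of `γ`. The domain `U` is an open
neighborhood of the axis, star-shaped in the transversal directions; `σ` is a local
diffeomorphism on it (it need not be injective, as `γ` may be closed); and for all `t` and `y` the
curve `s ↦ σ(t, s y)` is the geodesic which starts from `γ(t)` with velocity `∑ j, y_j e_j(t)`. -/
structure IsFermiCoordinates (h : Metric d N) (γ : ℝ → N)
    (e : Fin (d + 1) → (t : ℝ) → TangentSpace (𝓡 (d + 1)) (γ t))
    (U : Set (Coord d)) (σ : Coord d → N) : Prop where
  isOpen : IsOpen U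
  axis_mem : ∀ t, axis t ∈ U
  starShaped : ∀ (t : ℝ) (y : Fin d → ℝ), axis t + transversal y ∈ U →
    ∀ s ∈ Set.Icc (0 : ℝ) 1, axis t + s • transversal y ∈ U
  isLocalDiffeomorphOn : IsLocalDiffeomorphOn (𝓡 (d + 1)) (𝓡 (d + 1)) ∞ σ U
  geodesic : ∀ (t : ℝ) (y : Fin d → ℝ),
    IsGeodesicOn h (fun s : ℝ => σ (axis t + s • transversal y))
      {s : ℝ | axis t + s • transversal y ∈ U}
  initial : ∀ (t : ℝ) (y : Fin d → ℝ),
    (⟨σ (axis t + (0 : ℝ) • transversal y),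
        velocity (fun s : ℝ => σ (axis t + s • transversal y)) 0⟩ :
      TangentBundle (𝓡 (d + 1)) N)
    = ⟨γ t, ∑ j : Fin d, y j • e j.succ t⟩

end Manifold

end FermiCoord

end

namespace FermiCoord

/-! ### Calculus of partial derivatives on an open set -/

section PartialDerivatives

variable {d : ℕ} {U : Set (Coord d)} {f g : Coord d → ℝ}

/-! In Fermi coordinates the geometry leaves three facts about the components. All `Γ` vanish on the
axis: `γ` and the transversal lines are geodesics, and the parallel frame is the coordinate frame
there. The radial geodesics give `∑ x^a x^b Γ^i_{ab} = 0` on `U`, the sum running over transversal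
indices. Since `γ' = ∂_0`, local symmetry says `∇_0 ∇^n R = 0` on the axis for every `n`.

The rest is an induction on the order `m` of the Taylor coefficients (`AxisConst m`), run
simultaneously for `Γ` and for the whole tower `∇^n R`. At order 0, `∇_0` is `∂_0` on the axis
because `Γ` vanishes there. In the step, `∂_k ∇^n R` equals `∇_k ∇^n R` up to products of `Γ` and
`∇^n R`, so order `m` for `∇^{n+1} R` gives order `m + 1` for `∇^n R`.

For `Γ`, the curvature controls only the antisymmetrized derivatives `∂_j Γ_{kl} - ∂_k Γ_{jl}`
(upper index suppressed). The radial gauge supplies what is missing. With `V_l = ∑ x^a Γ_{al}` and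
the transversal Euler operator `E`, both `(1 + E) V_j` and `(1 + E) Γ_{jl} - ∂_j V_l` are expressed
by these antisymmetrized derivatives with factors `x^a`. Each such factor gains an order
(`AxisConst.coord_mul`), and `1 + E` is invertible on Taylor coefficients (`AxisConst.of_euler`).
This is carried out in `axisConst_succ_of_pd_sub`. -/

lemma differentiableAt_of_contDiffOn (hU : IsOpen U) (hf : ContDiffOn ℝ ∞ f U) {x : Coord d}
    (hx : x ∈ U) : DifferentiableAt ℝ f x :=
  (hf.contDiffAt (hU.mem_nhds hx)).differentiableAt (by simp)

lemma contDiffOn_pd (hU : IsOpen U) (hf : ContDiffOn ℝ ∞ f U) (i : Fin (d + 1)) :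
    ContDiffOn ℝ ∞ (pd i f) U :=
  (hf.fderiv_of_isOpen hU (by simp)).clm_apply contDiffOn_const

lemma contDiffOn_pdIter (hU : IsOpen U) (hf : ContDiffOn ℝ ∞ f U) (I : List (Fin (d + 1))) :
    ContDiffOn ℝ ∞ (pdIter I f) U := by
  induction I with
  | nil => exact hf
  | cons i I ih => exact contDiffOn_pd hU ih i

lemma eqOn_pd (hU : IsOpen U) (h : Set.EqOn f g U) (i : Fin (d + 1)) :
    Set.EqOn (pd i f) (pd i g) U := fun x hx => by
  have : f =ᶠ[nhds x] g := Filter.eventuallyEq_of_mem (hU.mem_nhds hx) h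
  simp only [pd, this.fderiv_eq]

lemma pd_const (i : Fin (d + 1)) (c : ℝ) (x : Coord d) : pd i (fun _ => c) x = 0 := by
  simp [pd]

lemma pd_add (hU : IsOpen U) (hf : ContDiffOn ℝ ∞ f U) (hg : ContDiffOn ℝ ∞ g U)
    (i : Fin (d + 1)) {x : Coord d} (hx : x ∈ U) :
    pd i (fun y => f y + g y) x = pd i f x + pd i g x := by
  simp only [pd]
  rw [fderiv_fun_add (differentiableAt_of_contDiffOn hU hf hx)
    (differentiableAt_of_contDiffOn hU hg hx)]
  rfl

lemma pd_mul (hU : IsOpen U) (hf : ContDiffOn ℝ ∞ f U) (hg : ContDiffOn ℝ ∞ g U)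
    (i : Fin (d + 1)) {x : Coord d} (hx : x ∈ U) :
    pd i (fun y => f y * g y) x = f x * pd i g x + g x * pd i f x := by
  simp only [pd]
  rw [fderiv_fun_mul (differentiableAt_of_contDiffOn hU hf hx)
    (differentiableAt_of_contDiffOn hU hg hx)]
  simp

lemma pd_const_mul (i : Fin (d + 1)) (c : ℝ) (hU : IsOpen U) (hf : ContDiffOn ℝ ∞ f U)
    {x : Coord d} (hx : x ∈ U) : pd i (fun y => c * f y) x = c * pd i f x := by
  rw [pd_mul hU contDiffOn_const hf i hx, pd_const]; ring

lemma pd_sum {ι : Type*} (s : Finset ι) {F : ι → Coord d → ℝ} (hU : IsOpen U)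
    (hF : ∀ a ∈ s, ContDiffOn ℝ ∞ (F a) U) (i : Fin (d + 1)) {x : Coord d} (hx : x ∈ U) :
    pd i (fun y => ∑ a ∈ s, F a y) x = ∑ a ∈ s, pd i (F a) x := by
  simp only [pd]
  rw [fderiv_fun_sum fun a ha => differentiableAt_of_contDiffOn hU (hF a ha) hx]
  simp

lemma pd_comm (hU : IsOpen U) (hf : ContDiffOn ℝ ∞ f U) (i j : Fin (d + 1)) :
    Set.EqOn (pd i (pd j f)) (pd j (pd i f)) U := fun x hx => by
  have hfx : ContDiffAt ℝ ∞ f x := hf.contDiffAt (hU.mem_nhds hx)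
  have hs : IsSymmSndFDerivAt ℝ f x := hfx.isSymmSndFDerivAt (by simpa using WithTop.coe_le_coe.2 (le_top : (2 : ℕ∞) ≤ ⊤))
  have hd : DifferentiableAt ℝ (fderiv ℝ f) x :=
    (hfx.fderiv_right (m := ∞) (by simp)).differentiableAt (by simp)
  have key : ∀ a b : Fin (d + 1),
      pd a (pd b f) x = fderiv ℝ (fderiv ℝ f) x (basisVec a) (basisVec b) := by
    intro a b
    change fderiv ℝ (fun y => fderiv ℝ f y (basisVec b)) x (basisVec a) = _
    rw [fderiv_clm_apply hd (differentiableAt_const _)]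
    simp
  rw [key, key, hs.eq]

lemma contDiff_coord (a : Fin (d + 1)) : ContDiff ℝ ∞ (fun x : Coord d => x a) :=
  (EuclideanSpace.proj (𝕜 := ℝ) a : Coord d →L[ℝ] ℝ).contDiff

lemma pd_coord (i a : Fin (d + 1)) (x : Coord d) :
    pd i (fun y : Coord d => y a) x = if a = i then 1 else 0 := by
  have : fderiv ℝ (fun y : Coord d => y a) x = (EuclideanSpace.proj (𝕜 := ℝ) a : Coord d →L[ℝ] ℝ) :=
    (EuclideanSpace.proj (𝕜 := ℝ) a : Coord d →L[ℝ] ℝ).hasFDerivAt.fderiv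
  simp [pd, this, basisVec]

lemma axis_eq (t : ℝ) : (axis t : Coord d) = t • basisVec 0 := by
  ext i
  simp [axis, basisVec]

lemma axis_succ (t : ℝ) (a : Fin d) : (axis t : Coord d) a.succ = 0 := by
  simp [axis]

lemma hasDerivAt_axis (t : ℝ) : HasDerivAt (axis : ℝ → Coord d) (basisVec 0) t := by
  have h := (hasDerivAt_id t).smul_const (basisVec 0 : Coord d)
  simp only [one_smul, id_eq] at h
  exact h.congr_of_eventuallyEq (Filter.Eventually.of_forall fun s => axis_eq s)

lemma hasDerivAt_comp_axis (hU : IsOpen U) (hf : ContDiffOn ℝ ∞ f U) {t : ℝ}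
    (ht : axis t ∈ U) : HasDerivAt (fun s => f (axis s)) (pd 0 f (axis t)) t :=
  (differentiableAt_of_contDiffOn hU hf ht).hasFDerivAt.comp_hasDerivAt t (hasDerivAt_axis t)

lemma pd_zero_axis_of_const (hU : IsOpen U) (hax : ∀ t, axis t ∈ U) (hf : ContDiffOn ℝ ∞ f U)
    {c : ℝ} (h : ∀ t, f (axis t) = c) (t : ℝ) : pd 0 f (axis t) = 0 := by
  have h1 := hasDerivAt_comp_axis hU hf (hax t)
  simp only [h] at h1
  exact h1.unique (hasDerivAt_const t c)

lemma axis_const_of_pd_zero (hU : IsOpen U) (hax : ∀ t, axis t ∈ U) (hf : ContDiffOn ℝ ∞ f U)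
    (h : ∀ t, pd 0 f (axis t) = 0) (s t : ℝ) : f (axis s) = f (axis t) :=
  is_const_of_deriv_eq_zero
    (fun r => (hasDerivAt_comp_axis hU hf (hax r)).differentiableAt)
    (fun r => (hasDerivAt_comp_axis hU hf (hax r)).deriv.trans (h r)) s t

lemma pdIter_append_singleton (I : List (Fin (d + 1))) (i : Fin (d + 1)) (f : Coord d → ℝ) :
    pdIter (I ++ [i]) f = pdIter I (pd i f) := by
  induction I with
  | nil => rfl
  | cons j I ih => simp [pdIter, ih]

end PartialDerivatives

/-! ### Functions with constant Taylor coefficients along the axis -/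

section AxisConst

variable {d : ℕ} {U : Set (Coord d)} {f g : Coord d → ℝ} {m : ℕ}

/-- The partial derivatives of `f` of order at most `m` are constant along the axis, in the sense
that their derivatives in the direction of the axis vanish there. -/
def AxisConst {d : ℕ} : ℕ → (Coord d → ℝ) → Prop
  | 0, f => ∀ t, pd 0 f (axis t) = 0
  | m + 1, f => (∀ t, pd 0 f (axis t) = 0) ∧ ∀ i, AxisConst m (pd i f)

lemma AxisConst.zero (h : AxisConst m f) : AxisConst 0 f := by
  cases m with
  | zero => exact h
  | succ m => exact h.1

lemma AxisConst.pd (h : AxisConst (m + 1) f) (i : Fin (d + 1)) : AxisConst m (pd i f) := h.2 i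

lemma AxisConst.pred (h : AxisConst (m + 1) f) : AxisConst m f := by
  induction m generalizing f with
  | zero => exact h.1
  | succ m ih => exact ⟨h.1, fun i => ih (h.2 i)⟩

lemma AxisConst.congr (hU : IsOpen U) (hax : ∀ t, axis t ∈ U) (h : AxisConst m f)
    (hfg : Set.EqOn f g U) : AxisConst m g := by
  induction m generalizing f g with
  | zero => exact fun t => (eqOn_pd hU hfg 0 (hax t)).symm.trans (h t)
  | succ m ih =>
    exact ⟨fun t => (eqOn_pd hU hfg 0 (hax t)).symm.trans (h.1 t),
      fun i => ih (h.2 i) (eqOn_pd hU hfg i)⟩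

lemma axisConst_const (c : ℝ) : AxisConst m (fun _ : Coord d => c) := by
  have h0 : ∀ i : Fin (d + 1), FermiCoord.pd i (fun _ : Coord d => c) = fun _ => 0 :=
    fun i => funext fun x => pd_const i c x
  induction m generalizing c with
  | zero => exact fun t => pd_const 0 c _
  | succ m ih =>
    refine ⟨fun t => pd_const 0 c _, fun i => ?_⟩
    rw [h0]
    exact ih 0 fun i => funext fun x => pd_const i 0 x

lemma AxisConst.add (hU : IsOpen U) (hax : ∀ t, axis t ∈ U) (hf : ContDiffOn ℝ ∞ f U)
    (hg : ContDiffOn ℝ ∞ g U) (h : AxisConst m f) (h' : AxisConst m g) :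
    AxisConst m (fun x => f x + g x) := by
  have h0 : ∀ t, FermiCoord.pd 0 (fun x => f x + g x) (axis t) = 0 := fun t => by
    rw [pd_add hU hf hg 0 (hax t), h.zero t, h'.zero t, add_zero]
  induction m generalizing f g with
  | zero => exact h0
  | succ m ih =>
    refine ⟨h0, fun i => ?_⟩
    have hs := contDiffOn_pd hU hf i
    have hs' := contDiffOn_pd hU hg i
    refine (ih hs hs' (h.2 i) (h'.2 i) fun t => ?_).congr hU hax
      fun x hx => (pd_add hU hf hg i hx).symm
    rw [pd_add hU hs hs' 0 (hax t), (h.2 i).zero t, (h'.2 i).zero t, add_zero]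

lemma AxisConst.mul (hU : IsOpen U) (hax : ∀ t, axis t ∈ U) (hf : ContDiffOn ℝ ∞ f U)
    (hg : ContDiffOn ℝ ∞ g U) (h : AxisConst m f) (h' : AxisConst m g) :
    AxisConst m (fun x => f x * g x) := by
  have h0 : ∀ t, FermiCoord.pd 0 (fun x => f x * g x) (axis t) = 0 := fun t => by
    rw [pd_mul hU hf hg 0 (hax t), h.zero t, h'.zero t]; ring
  induction m generalizing f g with
  | zero => exact h0
  | succ m ih =>
    refine ⟨h0, fun i => ?_⟩
    have key : ∀ {u v : Coord d → ℝ}, ContDiffOn ℝ ∞ u U → ContDiffOn ℝ ∞ v U →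
        AxisConst m u → AxisConst m v → AxisConst m (fun x => u x * v x) :=
      fun {u v} hu hv hu' hv' => ih hu hv hu' hv' fun t => by
        rw [pd_mul hU hu hv 0 (hax t), hu'.zero t, hv'.zero t]; ring
    have hs := contDiffOn_pd hU hf i
    have hs' := contDiffOn_pd hU hg i
    exact ((key hf hs' h.pred (h'.2 i)).add hU hax (hf.mul hs') (hg.mul hs)
      (key hg hs h'.pred (h.2 i))).congr hU hax fun x hx => (pd_mul hU hf hg i hx).symm

lemma AxisConst.const_mul (hU : IsOpen U) (hax : ∀ t, axis t ∈ U) (hf : ContDiffOn ℝ ∞ f U)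
    (c : ℝ) (h : AxisConst m f) : AxisConst m (fun x => c * f x) :=
  (axisConst_const c).mul hU hax contDiffOn_const hf h

lemma AxisConst.sub (hU : IsOpen U) (hax : ∀ t, axis t ∈ U) (hf : ContDiffOn ℝ ∞ f U)
    (hg : ContDiffOn ℝ ∞ g U) (h : AxisConst m f) (h' : AxisConst m g) :
    AxisConst m (fun x => f x - g x) :=
  (h.add hU hax hf (contDiffOn_const.mul hg) (h'.const_mul hU hax hg (-1))).congr hU hax
    fun x _ => by ring

lemma AxisConst.sum {ι : Type*} (s : Finset ι) {F : ι → Coord d → ℝ} (hU : IsOpen U)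
    (hax : ∀ t, axis t ∈ U) (hF : ∀ a ∈ s, ContDiffOn ℝ ∞ (F a) U)
    (h : ∀ a ∈ s, AxisConst m (F a)) : AxisConst m (fun x => ∑ a ∈ s, F a x) := by
  classical
  induction s using Finset.induction_on with
  | empty => simpa using axisConst_const 0
  | insert a s ha ih =>
    simp only [Finset.sum_insert ha]
    simp only [Finset.forall_mem_insert] at hF h
    exact h.1.add hU hax hF.1 (ContDiffOn.sum hF.2) (ih hF.2 h.2)

/-- No order is lost: `∂_0 ∂^I f = 0` holds at every point of the axis, so it may be differentiated
along the axis, and `∂_0` commutes with `∂^I`. -/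
lemma AxisConst.pd_zero (hU : IsOpen U) (hax : ∀ t, axis t ∈ U) (hf : ContDiffOn ℝ ∞ f U)
    (h : AxisConst m f) : AxisConst m (FermiCoord.pd 0 f) := by
  have h0 : ∀ t, FermiCoord.pd 0 (FermiCoord.pd 0 f) (axis t) = 0 :=
    pd_zero_axis_of_const hU hax (contDiffOn_pd hU hf 0) h.zero
  induction m generalizing f with
  | zero => exact h0
  | succ m ih =>
    refine ⟨h0, fun i => ?_⟩
    have hs := contDiffOn_pd hU hf i
    exact (ih hs (h.2 i) (pd_zero_axis_of_const hU hax (contDiffOn_pd hU hs 0)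
      (h.2 i).zero)).congr hU hax (pd_comm hU hf 0 i)

/-- The factor vanishes on the axis. A derivative that leaves it intact contributes nothing there,
and one that hits it has been spent, leaving one derivative fewer for `f`. -/
lemma AxisConst.coord_mul (hU : IsOpen U) (hax : ∀ t, axis t ∈ U) (hf : ContDiffOn ℝ ∞ f U)
    (h : AxisConst m f) (a : Fin d) : AxisConst (m + 1) (fun x => x a.succ * f x) := by
  have hc : ∀ b : Fin d, ContDiffOn ℝ ∞ (fun x : Coord d => x b.succ) U :=
    fun b => (contDiff_coord _).contDiffOn
  have hp : ∀ {u : Coord d → ℝ}, ContDiffOn ℝ ∞ u U → ∀ i : Fin (d + 1),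
      Set.EqOn (fun x => x a.succ * FermiCoord.pd i u x + (if a.succ = i then 1 else 0) * u x)
        (FermiCoord.pd i (fun x => x a.succ * u x)) U := fun {u} hu i x hx => by
    simp only []
    rw [pd_mul hU (hc a) hu i hx, pd_coord, mul_comm (u x)]
  have h0 : ∀ {u : Coord d → ℝ}, ContDiffOn ℝ ∞ u U →
      ∀ t, FermiCoord.pd 0 (fun x => x a.succ * u x) (axis t) = 0 := fun {u} hu t => by
    rw [← hp hu 0 (hax t)]
    simp [axis_succ]
  induction m generalizing f with
  | zero =>
    refine ⟨h0 hf, fun i => AxisConst.congr hU hax ?_ (hp hf i)⟩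
    have hs := contDiffOn_pd hU hf i
    exact AxisConst.add hU hax ((hc a).mul hs) (contDiffOn_const.mul hf)
      (h0 hs) (h.const_mul hU hax hf _)
  | succ m ih =>
    refine ⟨h0 hf, fun i => AxisConst.congr hU hax ?_ (hp hf i)⟩
    have hs := contDiffOn_pd hU hf i
    exact AxisConst.add hU hax ((hc a).mul hs) (contDiffOn_const.mul hf)
      (ih hs (h.2 i)) (h.const_mul hU hax hf _)

/-- The Euler operator in the transversal variables. -/
noncomputable def euler {d : ℕ} (f : Coord d → ℝ) (x : Coord d) : ℝ := ∑ a : Fin d, x a.succ * pd a.succ f x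

lemma contDiffOn_euler (hU : IsOpen U) (hf : ContDiffOn ℝ ∞ f U) : ContDiffOn ℝ ∞ (euler f) U :=
  ContDiffOn.sum fun a _ => (contDiff_coord _).contDiffOn.mul (contDiffOn_pd hU hf a.succ)

lemma pd_euler (hU : IsOpen U) (hf : ContDiffOn ℝ ∞ f U) (i : Fin (d + 1)) {x : Coord d}
    (hx : x ∈ U) : pd i (euler f) x = euler (pd i f) x + (if i = 0 then 0 else 1) * pd i f x := by
  have hc : ∀ b : Fin d, ContDiffOn ℝ ∞ (fun x : Coord d => x b.succ) U :=
    fun b => (contDiff_coord _).contDiffOn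
  change pd i (fun x => ∑ a : Fin d, x a.succ * pd a.succ f x) x = _
  rw [pd_sum _ hU (fun a _ => (hc a).mul (contDiffOn_pd hU hf a.succ)) i hx]
  have : ∀ a : Fin d, pd i (fun x => x a.succ * pd a.succ f x) x
      = x a.succ * pd a.succ (pd i f) x + (if a.succ = i then pd i f x else 0) := fun a => by
    rw [pd_mul hU (hc a) (contDiffOn_pd hU hf a.succ) i hx, pd_coord,
      pd_comm hU hf i a.succ hx]
    split_ifs with h
    · rw [h, mul_one]
    · simp
  simp only [this, Finset.sum_add_distrib, euler]
  congr 1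
  refine Fin.cases ?_ (fun b => ?_) i
  · simp
  · simp [Fin.succ_inj]

/-- On the axis `E` drops out and `c` can be divided away. A transversal derivative turns `c + E`
into `c + 1 + E`, and `∂_0` leaves it unchanged; hence the induction needs all positive `c`. -/
lemma AxisConst.of_euler (hU : IsOpen U) (hax : ∀ t, axis t ∈ U) (hf : ContDiffOn ℝ ∞ f U)
    {c : ℝ} (hc : 0 < c) (h : AxisConst m (fun x => c * f x + euler f x)) : AxisConst m f := by
  have hp : ∀ {u : Coord d → ℝ} (c : ℝ), ContDiffOn ℝ ∞ u U → ∀ i : Fin (d + 1),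
      Set.EqOn (FermiCoord.pd i (fun x => c * u x + euler u x))
        (fun x => (c + if i = 0 then 0 else 1) * FermiCoord.pd i u x
          + euler (FermiCoord.pd i u) x) U := fun {u} c hu i x hx => by
    rw [pd_add hU (contDiffOn_const.mul hu) (contDiffOn_euler hU hu) i hx,
      pd_const_mul i c hU hu hx, pd_euler hU hu i hx]
    ring
  have h0 : ∀ {u : Coord d → ℝ} {c : ℝ}, 0 < c → ContDiffOn ℝ ∞ u U →
      AxisConst 0 (fun x => c * u x + euler u x) → AxisConst 0 u := fun {u c} hc hu h t => by
    have h1 := h t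
    rw [hp c hu 0 (hax t)] at h1
    simpa [euler, axis_succ, hc.ne'] using h1
  induction m generalizing f c with
  | zero => exact h0 hc hf h
  | succ m ih =>
    refine ⟨h0 hc hf h.zero, fun i => ih (c := c + if i = 0 then 0 else 1)
      (contDiffOn_pd hU hf i) (by split_ifs <;> linarith) ?_⟩
    exact (h.2 i).congr hU hax (hp c hf i)

lemma AxisConst.pd_pdIter (I : List (Fin (d + 1))) (h : ∀ m, AxisConst m f) (t : ℝ) :
    FermiCoord.pd 0 (pdIter I f) (axis t) = 0 := by
  -- `AxisConst` peels off the innermost derivative, which is the last entry of the list.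
  induction I using List.reverseRecOn generalizing f with
  | nil => exact h 0 t
  | append_singleton I i ih =>
    rw [pdIter_append_singleton]
    exact ih fun m => (h (m + 1)).2 i

end AxisConst

end FermiCoord

namespace FermiCoord

/-! ### Smoothness and locality of the tensor expressions -/

section LocalSmoothness

variable {d : ℕ} {U : Set (Coord d)} {g g' : Coord d → Matrix (Fin (d + 1)) (Fin (d + 1)) ℝ}

lemma contDiffOn_det {ι : Type*} [Fintype ι] [DecidableEq ι] {A : Coord d → Matrix ι ι ℝ}
    (hA : ∀ i j, ContDiffOn ℝ ∞ (fun x => A x i j) U) :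
    ContDiffOn ℝ ∞ (fun x => (A x).det) U := by
  simp only [Matrix.det_apply']
  exact ContDiffOn.sum fun τ _ => contDiffOn_const.mul (contDiffOn_prod fun i _ => hA _ _)

lemma contDiffOn_matrix_inv (hg : ∀ i j, ContDiffOn ℝ ∞ (fun x => g x i j) U)
    (hdet : ∀ x ∈ U, (g x).det ≠ 0) (i j : Fin (d + 1)) :
    ContDiffOn ℝ ∞ (fun x => (g x)⁻¹ i j) U := by
  -- Cramer's rule makes the entries of the inverse quotients of determinants.
  have h1 : ∀ x, (g x)⁻¹ i j = (g x).det⁻¹ * ((g x).updateRow j (Pi.single i 1)).det := fun x => by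
    rw [Matrix.inv_def, Matrix.smul_apply, Matrix.adjugate_apply, Ring.inverse_eq_inv', smul_eq_mul]
  simp only [h1]
  refine ((contDiffOn_det hg).inv hdet).mul (contDiffOn_det fun k l => ?_)
  by_cases hk : k = j
  · subst hk
    simpa using contDiffOn_const
  · simpa [Matrix.updateRow_ne hk] using hg k l

lemma contDiffOn_christoffel (hU : IsOpen U) (hg : ∀ i j, ContDiffOn ℝ ∞ (fun x => g x i j) U)
    (hdet : ∀ x ∈ U, (g x).det ≠ 0) (k i j : Fin (d + 1)) :
    ContDiffOn ℝ ∞ (christoffel g k i j) U :=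
  contDiffOn_const.mul <| ContDiffOn.sum fun l _ => (contDiffOn_matrix_inv hg hdet k l).mul
    (((contDiffOn_pd hU (hg j l) i).add (contDiffOn_pd hU (hg i l) j)).sub
      (contDiffOn_pd hU (hg i j) l))

lemma contDiffOn_riemann (hU : IsOpen U)
    (hΓ : ∀ i j k, ContDiffOn ℝ ∞ (christoffel g i j k) U) (i j k l : Fin (d + 1)) :
    ContDiffOn ℝ ∞ (riemann g i j k l) U :=
  ((contDiffOn_pd hU (hΓ i k l) j).sub (contDiffOn_pd hU (hΓ i j l) k)).add
    (ContDiffOn.sum fun m _ => ((hΓ i j m).mul (hΓ m k l)).sub ((hΓ i k m).mul (hΓ m j l)))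

lemma contDiffOn_covDeriv (hU : IsOpen U)
    (hΓ : ∀ i j k, ContDiffOn ℝ ∞ (christoffel g i j k) U) {m : ℕ} {T : TensorComp d m}
    (hT : ∀ i J, ContDiffOn ℝ ∞ (T i J) U) (i : Fin (d + 1)) (J : Fin (m + 1) → Fin (d + 1)) :
    ContDiffOn ℝ ∞ (covDeriv g T i J) U :=
  ((contDiffOn_pd hU (hT i _) _).add
    (ContDiffOn.sum fun a _ => (hΓ _ _ _).mul (hT a _))).sub
    (ContDiffOn.sum fun _ _ => ContDiffOn.sum fun _ _ => (hΓ _ _ _).mul (hT i _))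

lemma contDiffOn_iterCovRiemann (hU : IsOpen U)
    (hΓ : ∀ i j k, ContDiffOn ℝ ∞ (christoffel g i j k) U) (n : ℕ) (i : Fin (d + 1))
    (J : Fin (3 + n) → Fin (d + 1)) : ContDiffOn ℝ ∞ (iterCovRiemann g n i J) U := by
  induction n generalizing i with
  | zero => exact contDiffOn_riemann hU hΓ _ _ _ _
  | succ n ih => exact contDiffOn_covDeriv hU hΓ (fun i J => ih i J) i J

lemma eqOn_christoffel (hU : IsOpen U) (h : Set.EqOn g g' U) (k i j : Fin (d + 1)) :
    Set.EqOn (christoffel g k i j) (christoffel g' k i j) U := fun x hx => by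
  have hp : ∀ a b c, pd a (fun y => g y b c) x = pd a (fun y => g' y b c) x := fun a b c =>
    eqOn_pd hU (fun y hy => by simp only [h hy]) a hx
  simp only [christoffel, hp, h hx]

lemma eqOn_riemann (hU : IsOpen U) (h : Set.EqOn g g' U) (i j k l : Fin (d + 1)) :
    Set.EqOn (riemann g i j k l) (riemann g' i j k l) U := fun x hx => by
  simp only [riemann, eqOn_christoffel hU h _ _ _ hx,
    eqOn_pd hU (eqOn_christoffel hU h _ _ _) _ hx]

lemma eqOn_covDeriv (hU : IsOpen U) (h : Set.EqOn g g' U) {m : ℕ} {T T' : TensorComp d m}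
    (hT : ∀ i J, Set.EqOn (T i J) (T' i J) U) (i : Fin (d + 1)) (J : Fin (m + 1) → Fin (d + 1)) :
    Set.EqOn (covDeriv g T i J) (covDeriv g' T' i J) U := fun x hx => by
  simp only [covDeriv, eqOn_christoffel hU h _ _ _ hx, hT _ _ hx, eqOn_pd hU (hT _ _) _ hx]

lemma eqOn_iterCovRiemann (hU : IsOpen U) (h : Set.EqOn g g' U) (n : ℕ) (i : Fin (d + 1))
    (J : Fin (3 + n) → Fin (d + 1)) :
    Set.EqOn (iterCovRiemann g n i J) (iterCovRiemann g' n i J) U := by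
  induction n generalizing i with
  | zero => exact eqOn_riemann hU h _ _ _ _
  | succ n ih => exact eqOn_covDeriv hU h (fun i J => ih i J) i J

lemma christoffel_symm (hsym : ∀ x i j, g x i j = g x j i) (k i j : Fin (d + 1)) :
    christoffel g k i j = christoffel g k j i := by
  have h : ∀ a b, (fun y => g y a b) = fun y => g y b a := fun a b => funext fun y => hsym y a b
  funext x
  simp only [christoffel]
  congr 1
  refine Finset.sum_congr rfl fun l _ => ?_
  rw [h i j]
  ring

end LocalSmoothness

/-! ### Induction on the order of the Taylor coefficients -/

section Propagation

variable {d : ℕ} {U : Set (Coord d)} {g : Coord d → Matrix (Fin (d + 1)) (Fin (d + 1)) ℝ} {m : ℕ}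

lemma axisConst_zero_of_covDeriv_zero
    (hΓ0 : ∀ i j k t, christoffel g i j k (axis t) = 0) {n : ℕ} {T : TensorComp d n}
    (h : ∀ i (J : Fin n → Fin (d + 1)) t,
      covDeriv g T i (Fin.cons 0 J : Fin (n + 1) → Fin (d + 1)) (axis t) = 0)
    (i : Fin (d + 1)) (J : Fin n → Fin (d + 1)) : AxisConst 0 (T i J) := fun t => by
  have := h i J t
  simpa [covDeriv, hΓ0] using this

/-- Solving the formula for `∇_k T` for `∂_k T` leaves only terms known to order `m`. The need for
`∇T` is what forces the induction to carry all `∇^n R` at once. -/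
lemma axisConst_succ_of_covDeriv (hU : IsOpen U) (hax : ∀ t, axis t ∈ U)
    (hΓ : ∀ i j k, ContDiffOn ℝ ∞ (christoffel g i j k) U)
    (hΓm : ∀ i j k, AxisConst m (christoffel g i j k)) {n : ℕ} {T : TensorComp d n}
    (hT : ∀ i J, ContDiffOn ℝ ∞ (T i J) U) (hTm : ∀ i J, AxisConst m (T i J))
    (hDT : ∀ i J, AxisConst m (covDeriv g T i J))
    (i : Fin (d + 1)) (J : Fin n → Fin (d + 1)) : AxisConst (m + 1) (T i J) := by
  refine ⟨(hTm i J).zero, fun k => ?_⟩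
  have h1 := contDiffOn_covDeriv hU hΓ hT i (Fin.cons k J)
  have s2 : ∀ a ∈ Finset.univ,
      ContDiffOn ℝ ∞ (fun x => christoffel g i k a x * T a J x) U :=
    fun a _ => (hΓ i k a).mul (hT a J)
  have s3 : ∀ p : Fin n, ∀ a ∈ Finset.univ, ContDiffOn ℝ ∞
      (fun x => christoffel g a k (J p) x * T i (Function.update J p a) x) U :=
    fun p a _ => (hΓ a k _).mul (hT i _)
  have s3' : ∀ p ∈ Finset.univ, ContDiffOn ℝ ∞
      (fun x => ∑ a, christoffel g a k (J p) x * T i (Function.update J p a) x) U :=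
    fun p _ => ContDiffOn.sum (s3 p)
  have c2 := AxisConst.sum Finset.univ hU hax s2
    fun a _ => (hΓm i k a).mul hU hax (hΓ i k a) (hT a J) (hTm a J)
  have c3 := AxisConst.sum Finset.univ hU hax s3' fun p _ =>
    AxisConst.sum Finset.univ hU hax (s3 p) fun a _ =>
      (hΓm a k (J p)).mul hU hax (hΓ a k (J p)) (hT i _) (hTm i _)
  refine ((((hDT i (Fin.cons k J)).sub hU hax h1 (ContDiffOn.sum s2) c2).add hU hax
    (h1.sub (ContDiffOn.sum s2)) (ContDiffOn.sum s3') c3)).congr hU hax fun x _ => ?_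
  simp only [covDeriv, Fin.cons_zero, Fin.tail_cons]
  ring

/-- The quadratic terms `ΓΓ` of the curvature are already known to order `m`. -/
lemma axisConst_pd_christoffel_sub (hU : IsOpen U) (hax : ∀ t, axis t ∈ U)
    (hΓ : ∀ i j k, ContDiffOn ℝ ∞ (christoffel g i j k) U)
    (hΓm : ∀ i j k, AxisConst m (christoffel g i j k))
    (hR : ∀ i j k l, AxisConst m (riemann g i j k l)) (i j k l : Fin (d + 1)) :
    AxisConst m (fun x => pd j (christoffel g i k l) x - pd k (christoffel g i j l) x) := by
  have s2 : ∀ a ∈ Finset.univ, ContDiffOn ℝ ∞ (fun x => christoffel g i j a x *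
      christoffel g a k l x - christoffel g i k a x * christoffel g a j l x) U :=
    fun a _ => ((hΓ i j a).mul (hΓ a k l)).sub ((hΓ i k a).mul (hΓ a j l))
  have c2 := AxisConst.sum Finset.univ hU hax s2 fun a _ =>
    ((hΓm i j a).mul hU hax (hΓ i j a) (hΓ a k l) (hΓm a k l)).sub hU hax
      ((hΓ i j a).mul (hΓ a k l)) ((hΓ i k a).mul (hΓ a j l))
      ((hΓm i k a).mul hU hax (hΓ i k a) (hΓ a j l) (hΓm a j l))
  refine ((hR i j k l).sub hU hax (contDiffOn_riemann hU hΓ i j k l)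
    (ContDiffOn.sum s2) c2).congr hU hax fun x _ => ?_
  simp only [riemann]
  ring

/-- If the coefficients `Γ_{jk}` of a symmetric bilinear form annihilate the transversal position
vector, then they are determined up to order `m + 1` by the antisymmetrized derivatives
`∂_j Γ_{kl} - ∂_k Γ_{jl}` up to order `m`. -/
lemma axisConst_succ_of_pd_sub (hU : IsOpen U) (hax : ∀ t, axis t ∈ U)
    {Γ : Fin (d + 1) → Fin (d + 1) → Coord d → ℝ} (hΓ : ∀ j k, ContDiffOn ℝ ∞ (Γ j k) U)
    (hsym : ∀ j k, Γ j k = Γ k j) (hΓm : ∀ j k, AxisConst m (Γ j k))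
    (hrad : ∀ x ∈ U, ∑ a : Fin d, ∑ b : Fin d, x a.succ * (x b.succ * Γ a.succ b.succ x) = 0)
    (hX : ∀ j k l, AxisConst m (fun x => pd j (Γ k l) x - pd k (Γ j l) x))
    (j k : Fin (d + 1)) : AxisConst (m + 1) (Γ j k) := by
  have hc : ∀ b : Fin d, ContDiffOn ℝ ∞ (fun x : Coord d => x b.succ) U :=
    fun b => (contDiff_coord _).contDiffOn
  have sX : ∀ j k l, ContDiffOn ℝ ∞ (fun x => pd j (Γ k l) x - pd k (Γ j l) x) U :=
    fun j k l => (contDiffOn_pd hU (hΓ k l) j).sub (contDiffOn_pd hU (hΓ j l) k)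
  -- The contraction of `Γ` with the transversal position vector; the radial condition becomes `∑
  -- x^b V_b = 0`.
  set V : Fin (d + 1) → Coord d → ℝ := fun l x => ∑ a : Fin d, x a.succ * Γ a.succ l x with hV
  have sV : ∀ l, ContDiffOn ℝ ∞ (V l) U :=
    fun l => ContDiffOn.sum fun a _ => (hc a).mul (hΓ a.succ l)
  have pdV : ∀ (j : Fin d) l, ∀ x ∈ U,
      pd j.succ (V l) x = Γ j.succ l x + ∑ a : Fin d, x a.succ * pd j.succ (Γ a.succ l) x := by
    intro j l x hx
    simp only [hV]
    rw [pd_sum _ hU (fun a _ => (hc a).mul (hΓ a.succ l)) _ hx]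
    have : ∀ a : Fin d, pd j.succ (fun x => x a.succ * Γ a.succ l x) x
        = (if a = j then Γ a.succ l x else 0) + x a.succ * pd j.succ (Γ a.succ l) x := fun a => by
      rw [pd_mul hU (hc a) (hΓ a.succ l) _ hx, pd_coord]
      simp only [Fin.succ_inj]
      split_ifs <;> ring
    simp [this, Finset.sum_add_distrib]
  have eulerΓ : ∀ (j : Fin d) l, ∀ x ∈ U, 1 * Γ j.succ l x + euler (Γ j.succ l) x
      = pd j.succ (V l) x - ∑ a : Fin d, x a.succ *
        (pd j.succ (Γ a.succ l) x - pd a.succ (Γ j.succ l) x) := by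
    intro j l x hx
    rw [pdV j l x hx]
    simp only [euler, mul_sub, Finset.sum_sub_distrib]
    ring
  have eulerV : ∀ j : Fin d, ∀ x ∈ U, 1 * V j.succ x + euler (V j.succ) x
      = ∑ b : Fin d, ∑ a : Fin d, x b.succ * (x a.succ *
        (pd b.succ (Γ a.succ j.succ) x - pd j.succ (Γ a.succ b.succ) x)) := by
    intro j x hx
    -- Differentiating `∑ x^b V_b = 0` by `∂_j` gives `2 V_j + ∑ x^b x^a ∂_j Γ_{ab} = 0`, whereas `E
    -- V_j = V_j + ∑ x^b x^a ∂_b Γ_{aj}`; adding `V_j` to the latter and eliminating `2 V_j` proves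
    -- the identity.
    have hF : pd j.succ (fun x => ∑ b : Fin d, x b.succ * V b.succ x) x = 0 := by
      have : Set.EqOn (fun x => ∑ b : Fin d, x b.succ * V b.succ x) (fun _ => 0) U := by
        intro y hy
        simp only [hV, Finset.mul_sum]
        rw [← hrad y hy]
        refine Finset.sum_congr rfl fun a _ => Finset.sum_congr rfl fun b _ => ?_
        rw [hsym]
      rw [eqOn_pd hU this _ hx, pd_const]
    rw [pd_sum _ hU (fun a _ => (hc a).mul (sV a.succ)) _ hx] at hF
    have h1 : ∀ b : Fin d, pd j.succ (fun x => x b.succ * V b.succ x) x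
        = (if b = j then V b.succ x else 0) + (x b.succ * Γ b.succ j.succ x
          + ∑ a : Fin d, x b.succ * (x a.succ * pd j.succ (Γ a.succ b.succ) x)) := fun b => by
      rw [pd_mul hU (hc b) (sV b.succ) _ hx, pd_coord, pdV j b.succ x hx, hsym b.succ,
        ← Finset.mul_sum]
      simp only [Fin.succ_inj]
      split_ifs <;> ring
    have h2 : ∀ b : Fin d, x b.succ * pd b.succ (V j.succ) x = x b.succ * Γ b.succ j.succ x
        + ∑ a : Fin d, x b.succ * (x a.succ * pd b.succ (Γ a.succ j.succ) x) := fun b => by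
      rw [pdV b j.succ x hx, ← Finset.mul_sum]
      ring
    simp only [h1, Finset.sum_add_distrib, Finset.sum_ite_eq', Finset.mem_univ, if_true] at hF
    simp only [euler, h2, Finset.sum_add_distrib, mul_sub, Finset.sum_sub_distrib]
    linarith
  -- Two coordinate factors raise the order by two, so that `∂_j V_l` below still has order `m + 1`.
  have cV : ∀ j : Fin d, AxisConst (m + 2) (V j.succ) := by
    intro j
    refine AxisConst.of_euler hU hax (sV j.succ) one_pos ?_
    refine AxisConst.congr hU hax ?_ fun x hx => (eulerV j x hx).symm
    have s1 : ∀ b : Fin d, ∀ a ∈ (Finset.univ : Finset (Fin d)), ContDiffOn ℝ ∞ (fun x : Coord d => x b.succ *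
        (x a.succ * (pd b.succ (Γ a.succ j.succ) x - pd j.succ (Γ a.succ b.succ) x))) U :=
      fun b a _ => (hc b).mul ((hc a).mul
        ((contDiffOn_pd hU (hΓ _ _) _).sub (contDiffOn_pd hU (hΓ _ _) _)))
    refine AxisConst.sum _ hU hax (fun b _ => ContDiffOn.sum (s1 b)) fun b _ =>
      AxisConst.sum _ hU hax (s1 b) fun a _ => ?_
    have hX' := hX b.succ j.succ a.succ
    have sX' := sX b.succ j.succ a.succ
    rw [hsym j.succ, hsym b.succ] at hX' sX'
    exact (hX'.coord_mul hU hax sX' a).coord_mul hU hax ((hc a).mul sX') b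
  have cT : ∀ (j : Fin d) l, (AxisConst (m + 2) (V l)) → AxisConst (m + 1) (Γ j.succ l) := by
    intro j l hl
    refine AxisConst.of_euler hU hax (hΓ j.succ l) one_pos ?_
    refine AxisConst.congr hU hax ?_ fun x hx => (eulerΓ j l x hx).symm
    have s1 : ∀ a ∈ (Finset.univ : Finset (Fin d)), ContDiffOn ℝ ∞ (fun x : Coord d => x a.succ *
        (pd j.succ (Γ a.succ l) x - pd a.succ (Γ j.succ l) x)) U :=
      fun a _ => (hc a).mul (sX _ _ _)
    exact (hl.pd j.succ).sub hU hax (contDiffOn_pd hU (sV l) _) (ContDiffOn.sum s1)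
      (AxisConst.sum _ hU hax s1 fun a _ => (hX _ _ _).coord_mul hU hax (sX _ _ _) a)
  -- Here `∂_i Γ_{0l}` is an antisymmetrized derivative plus `∂_0 Γ_{il}`, and `∂_0` costs no order.
  have cZ : ∀ l, AxisConst (m + 1) (Γ 0 l) := by
    intro l
    refine ⟨(hΓm 0 l).zero, fun i => ?_⟩
    have sp : ContDiffOn ℝ ∞ (pd 0 (Γ i l)) U := contDiffOn_pd hU (hΓ i l) 0
    refine ((hX i 0 l).add hU hax (sX i 0 l) sp
      ((hΓm i l).pd_zero hU hax (hΓ i l))).congr hU hax fun x _ => ?_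
    ring
  refine Fin.cases (cZ k) (fun j => ?_) j
  refine Fin.cases ?_ (fun k => cT j k.succ (cV k)) k
  -- `V_0` has not been controlled, so `Γ_{j0}` is reached through `Γ_{0j}`.
  rw [hsym]
  exact cZ _

/-- In coordinates in which the Christoffel symbols vanish on the axis and annihilate the
transversal position vector, the vanishing of `∇_0 ∇^n R` on the axis for all `n` makes all Taylor
coefficients of the Christoffel symbols and of the iterated covariant derivatives of the curvature
constant along the axis. -/
lemma axisConst_christoffel_and_iterCovRiemann (hU : IsOpen U) (hax : ∀ t, axis t ∈ U)
    (hΓ : ∀ i j k, ContDiffOn ℝ ∞ (christoffel g i j k) U)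
    (hsym : ∀ x i j, g x i j = g x j i)
    (hΓ0 : ∀ i j k t, christoffel g i j k (axis t) = 0)
    (hrad : ∀ i, ∀ x ∈ U, ∑ a : Fin d, ∑ b : Fin d,
      x a.succ * (x b.succ * christoffel g i a.succ b.succ x) = 0)
    (hR : ∀ n i (J : Fin (3 + n) → Fin (d + 1)) t,
      covDeriv g (iterCovRiemann g n) i (Fin.cons 0 J : Fin (3 + n + 1) → Fin (d + 1))
        (axis t) = 0) (m : ℕ) :
    (∀ i j k, AxisConst m (christoffel g i j k)) ∧
      ∀ n i (J : Fin (3 + n) → Fin (d + 1)), AxisConst m (iterCovRiemann g n i J) := by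
  induction m with
  | zero =>
    exact ⟨fun i j k => pd_zero_axis_of_const hU hax (hΓ i j k) (hΓ0 i j k),
      fun n => axisConst_zero_of_covDeriv_zero hΓ0 (hR n)⟩
  | succ m ih =>
    have hR' : ∀ i j k l, AxisConst m (riemann g i j k l) :=
      fun i j k l => ih.2 0 i ![j, k, l]
    exact ⟨fun i => axisConst_succ_of_pd_sub hU hax (hΓ i) (christoffel_symm hsym i) (ih.1 i)
        (hrad i) (axisConst_pd_christoffel_sub hU hax hΓ ih.1 hR' i),
      fun n => axisConst_succ_of_covDeriv hU hax hΓ ih.1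
        (contDiffOn_iterCovRiemann hU hΓ n) (ih.2 n) (ih.2 (n + 1))⟩

end Propagation

end FermiCoord

namespace FermiCoord

/-! ### Metric components in a parametrization -/

section MetricComponents

variable {d : ℕ} {N : Type*} [TopologicalSpace N] [ChartedSpace (Coord d) N]
  [IsManifold (𝓡 (d + 1)) ∞ N]

lemma contDiffOn_metricComp (h : Metric d N) {U : Set (Coord d)} (hU : IsOpen U)
    {ψ : Coord d → N} (hψ : ContMDiffOn (𝓡 (d + 1)) (𝓡 (d + 1)) ∞ ψ U) (i j : Fin (d + 1)) :
    ContDiffOn ℝ ∞ (fun x => metricComp h ψ x i j) U := by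
  intro x hx
  have hψx := hψ.contMDiffAt (hU.mem_nhds hx)
  -- The pushforward of a constant vector field is the tangent map of `ψ` composed with a smooth
  -- section.
  have hvec : ∀ v : Coord d, ContMDiffAt (𝓡 (d + 1)) (𝓡 (d + 1)).tangent ∞
      (fun y : Coord d => (⟨ψ y, mfderiv (𝓡 (d + 1)) (𝓡 (d + 1)) ψ y v⟩ :
        TangentBundle (𝓡 (d + 1)) N)) x := by
    intro v
    have h1 : ContMDiff (𝓡 (d + 1)) (𝓡 (d + 1)).tangent ∞
        (fun y : Coord d => (⟨y, v⟩ : TangentBundle (𝓡 (d + 1)) (Coord d))) :=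
      fun y => contMDiffAt_vectorSpace_iff_contDiffAt.2 contDiffAt_const
    have h2 := (hψ.contMDiffOn_tangentMapWithin (m := ∞) (by simp) hU.uniqueMDiffOn).comp
      h1.contMDiffOn (s := U) (fun y hy => hy)
    refine (h2.contMDiffAt (hU.mem_nhds hx)).congr_of_eventuallyEq ?_
    filter_upwards [hU.mem_nhds hx] with y hy
    simp only [Function.comp, tangentMapWithin, mfderivWithin_of_isOpen hU hy]
  have h3 : ContMDiffAt (𝓡 (d + 1)) ((𝓡 (d + 1)).prod 𝓘(ℝ)) ∞
      (fun y => Bundle.TotalSpace.mk' ℝ (E := Bundle.Trivial N ℝ) (ψ y)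
        (metricComp h ψ y i j)) x := by
    apply ContMDiffAt.clm_bundle_apply₂ (F₁ := Coord d) (F₂ := Coord d)
    · exact h.contMDiff.contMDiffAt.comp x hψx
    · exact hvec (basisVec i)
    · exact hvec (basisVec j)
  rw [Bundle.contMDiffAt_totalSpace] at h3
  exact h3.2.contDiffAt.contDiffWithinAt

lemma metricComp_symm (h : Metric d N) (ψ : Coord d → N) (x : Coord d) (i j : Fin (d + 1)) :
    metricComp h ψ x i j = metricComp h ψ x j i :=
  h.symm _ _ _

/-- The matrix is the Gram matrix of the vectors `∂_i ψ`: a kernel vector would give a nonzero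
tangent vector of length zero. -/
lemma det_metricComp_ne_zero (h : Metric d N) {ψ : Coord d → N} {x : Coord d}
    (hψ : Function.Injective (mfderiv (𝓡 (d + 1)) (𝓡 (d + 1)) ψ x)) :
    (metricComp h ψ x).det ≠ 0 := by
  intro hdet
  obtain ⟨v, hv0, hv⟩ := Matrix.exists_mulVec_eq_zero_iff.2 hdet
  set D : Coord d →L[ℝ] TangentSpace (𝓡 (d + 1)) (ψ x) :=
    mfderiv (𝓡 (d + 1)) (𝓡 (d + 1)) ψ x with hD
  set w : Coord d := ∑ i, v i • basisVec i with hw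
  have hw0 : w ≠ 0 := by
    intro h0
    apply hv0
    ext i
    have := congrArg (fun u : Coord d => u i) h0
    simpa [hw, basisVec, Finset.sum_apply, Pi.single_apply] using this
  have hDw : D w ≠ 0 := fun h0 => hw0 (hψ (h0.trans (map_zero D).symm))
  refine (h.pos (ψ x) (D w) hDw).ne' ?_
  have h1 : h.inner (ψ x) (D w) (D w) = ∑ i, v i * ∑ j, metricComp h ψ x i j * v j := by
    simp only [hw, map_sum, map_smul, sum_apply,
      smul_apply, smul_eq_mul]
    refine Finset.sum_congr rfl fun i _ => ?_
    congr 1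
    refine Finset.sum_congr rfl fun j _ => ?_
    rw [h.symm, mul_comm]
    rfl
  rw [h1]
  refine Finset.sum_eq_zero fun i _ => ?_
  have := congrFun hv i
  simp only [Matrix.mulVec, dotProduct, Pi.zero_apply] at this
  rw [this, mul_zero]

lemma eqOn_metricComp (h : Metric d N) {ψ ψ' : Coord d → N} {V : Set (Coord d)} (hV : IsOpen V)
    (hψ : Set.EqOn ψ ψ' V) : Set.EqOn (metricComp h ψ) (metricComp h ψ') V := by
  intro x hx
  have h1 : ψ =ᶠ[nhds x] ψ' := Filter.eventuallyEq_of_mem (hV.mem_nhds hx) hψ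
  have h2 : ∀ {p q : N}, p = q → ∀ v w : Coord d,
      h.inner p (v : TangentSpace (𝓡 (d + 1)) p) (w : TangentSpace (𝓡 (d + 1)) p)
        = h.inner q (v : TangentSpace (𝓡 (d + 1)) q) (w : TangentSpace (𝓡 (d + 1)) q) := by
    rintro p q rfl v w
    rfl
  ext i j
  have h3 := h1.mfderiv_eq (I := 𝓡 (d + 1)) (I' := 𝓡 (d + 1))
  simp only [metricComp, Matrix.of_apply]
  rw [h3]
  exact h2 (hψ hx) _ _

/-- A local inverse of `σ` is an admissible chart. Through it the chartwise conditions (geodesic,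
parallel, locally symmetric) become statements about `metricComp h σ`. -/
lemma exists_chart_of_isLocalDiffeomorphAt {σ : Coord d → N} {x : Coord d}
    (hσ : IsLocalDiffeomorphAt (𝓡 (d + 1)) (𝓡 (d + 1)) ∞ σ x) :
    ∃ φ ∈ IsManifold.maximalAtlas (𝓡 (d + 1)) ∞ N, x ∈ φ.target ∧
      Set.EqOn σ φ.symm φ.target := by
  obtain ⟨Φ, hx, hΦ⟩ := hσ
  exact ⟨Φ.toOpenPartialHomeomorph.symm,
    Φ.toOpenPartialHomeomorph.symm.mem_maximalAtlas_of_contMDiffOn Φ.contMDiffOn_invFun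
      Φ.contMDiffOn_toFun, hx, hΦ⟩

end MetricComponents

/-! ### Coordinate lines read in a chart -/

section Lines

variable {d : ℕ}

lemma hasDerivAt_line (q v : Coord d) (t : ℝ) : HasDerivAt (fun s : ℝ => q + s • v) v t := by
  simpa using ((hasDerivAt_id t).smul_const v).const_add q

lemma eventually_deriv_coord_of_eq_line {f : ℝ → Coord d} {q v : Coord d} {t : ℝ}
    (hf : ∀ᶠ s in nhds t, f s = q + s • v) (i : Fin (d + 1)) :
    ∀ᶠ s in nhds t, deriv (fun r => f r i) s = v i := by
  filter_upwards [hf.eventually_nhds] with s hs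
  have h1 : (fun r => f r i) =ᶠ[nhds s] fun r => q i + r * v i := by
    filter_upwards [hs] with r hr
    simp [hr]
  rw [h1.deriv_eq]
  simp

lemma axis_add_transversal (x : Coord d) :
    (axis (x 0) + transversal fun a => x a.succ : Coord d) = x := by
  ext i
  refine Fin.cases ?_ (fun a => ?_) i <;> simp [axis, transversal]

lemma transversal_zero_apply (y : Fin d → ℝ) : transversal y 0 = 0 := rfl

lemma transversal_succ_apply (y : Fin d → ℝ) (a : Fin d) : transversal y a.succ = y a := rfl

lemma eventually_chart_line {N : Type*} [TopologicalSpace N] {σ : Coord d → N}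
    {φ : OpenPartialHomeomorph N (Coord d)}
    (hφ : Set.EqOn σ φ.symm φ.target) {q v : Coord d} {t : ℝ} (ht : q + t • v ∈ φ.target) :
    ∀ᶠ s in nhds t, φ (σ (q + s • v)) = q + s • v := by
  have hc : ContinuousAt (fun s : ℝ => q + s • v) t := (hasDerivAt_line q v t).continuousAt
  filter_upwards [hc.preimage_mem_nhds (φ.open_target.mem_nhds ht)] with s hs
  rw [hφ hs, φ.right_inv hs]

lemma chart_mem_source {N : Type*} [TopologicalSpace N] {σ : Coord d → N}
    {φ : OpenPartialHomeomorph N (Coord d)}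
    (hφ : Set.EqOn σ φ.symm φ.target) {x : Coord d} (hx : x ∈ φ.target) :
    σ x ∈ φ.source ∧ φ (σ x) = x := by
  rw [hφ hx]
  exact ⟨φ.map_target hx, φ.right_inv hx⟩

end Lines

section LineInChart

variable {d : ℕ} {N : Type*} [TopologicalSpace N] [ChartedSpace (Coord d) N]
  [IsManifold (𝓡 (d + 1)) ∞ N]

/-- If the image of a line under a local diffeomorphism is a geodesic, then the Christoffel symbols
annihilate the direction of the line. -/
lemma christoffel_of_geodesic_line (h : Metric d N) {σ : Coord d → N} {q v : Coord d} {S : Set ℝ}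
    (hc : IsGeodesicOn h (fun s => σ (q + s • v)) S) {t : ℝ} (ht : t ∈ S)
    (hσ : IsLocalDiffeomorphAt (𝓡 (d + 1)) (𝓡 (d + 1)) ∞ σ (q + t • v)) (i : Fin (d + 1)) :
    ∑ j, ∑ k, christoffel (metricComp h σ) i j k (q + t • v) * v j * v k = 0 := by
  obtain ⟨φ, hφ, hx, hEq⟩ := exists_chart_of_isLocalDiffeomorphAt hσ
  obtain ⟨hs, hv⟩ := chart_mem_source hEq hx
  have hd := eventually_deriv_coord_of_eq_line (eventually_chart_line hEq hx)
  have h1 := hc.2 φ hφ t ht hs i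
  have h2 : deriv (deriv fun s => φ (σ (q + s • v)) i) t = 0 := by
    have : (deriv fun s => φ (σ (q + s • v)) i) =ᶠ[nhds t] fun _ => v i := hd i
    rw [this.deriv_eq, deriv_const]
  rw [h2, zero_add] at h1
  rw [← h1]
  refine Finset.sum_congr rfl fun j _ => Finset.sum_congr rfl fun k _ => ?_
  rw [(hd j).self_of_nhds, (hd k).self_of_nhds, hv,
    eqOn_christoffel φ.open_target (eqOn_metricComp h φ.open_target hEq) i j k hx]

end LineInChart

/-! ### Geometric input from Fermi coordinates -/

namespace IsFermiCoordinates

variable {d : ℕ} {N : Type*} [TopologicalSpace N] [ChartedSpace (Coord d) N]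
  [IsManifold (𝓡 (d + 1)) ∞ N] {h : Metric d N} {γ : ℝ → N}
  {e : Fin (d + 1) → (t : ℝ) → TangentSpace (𝓡 (d + 1)) (γ t)} {U : Set (Coord d)}
  {σ : Coord d → N}

lemma localDiffeo (hσ : IsFermiCoordinates h γ e U σ) {x : Coord d} (hx : x ∈ U) :
    IsLocalDiffeomorphAt (𝓡 (d + 1)) (𝓡 (d + 1)) ∞ σ x :=
  hσ.isLocalDiffeomorphOn ⟨x, hx⟩

lemma contDiffOn_christoffel (hσ : IsFermiCoordinates h γ e U σ) (k i j : Fin (d + 1)) :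
    ContDiffOn ℝ ∞ (christoffel (metricComp h σ) k i j) U :=
  FermiCoord.contDiffOn_christoffel hσ.isOpen
    (contDiffOn_metricComp h hσ.isOpen hσ.isLocalDiffeomorphOn.contMDiffOn)
    (fun _ hx => det_metricComp_ne_zero h
      ((hσ.localDiffeo hx).mfderivToContinuousLinearEquiv (by simp)).injective) k i j

lemma apply_axis (hσ : IsFermiCoordinates h γ e U σ) (t : ℝ) : σ (axis t) = γ t := by
  have := congrArg Bundle.TotalSpace.proj (hσ.initial t 0)
  simpa using this

lemma curve_eq (hσ : IsFermiCoordinates h γ e U σ) :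
    γ = fun s => σ ((0 : Coord d) + s • basisVec 0) := by
  funext s
  rw [zero_add, ← axis_eq, hσ.apply_axis]

lemma line_mem (hσ : IsFermiCoordinates h γ e U σ) (t : ℝ) :
    (0 : Coord d) + t • basisVec 0 ∈ U := by
  rw [zero_add, ← axis_eq]
  exact hσ.axis_mem t

/-- `y` and `s` are kept apart: `s = 1` gives the radial identity on `U`, and `s = 0` gives a
quadratic form in arbitrary `y` at a point of the axis. -/
lemma christoffel_radial (hσ : IsFermiCoordinates h γ e U σ) (i : Fin (d + 1)) (t : ℝ)
    (y : Fin d → ℝ) {s : ℝ} (hs : axis t + s • transversal y ∈ U) :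
    ∑ a : Fin d, ∑ b : Fin d, y a * (y b *
      christoffel (metricComp h σ) i a.succ b.succ (axis t + s • transversal y)) = 0 := by
  have := christoffel_of_geodesic_line h (hσ.geodesic t y) hs (hσ.localDiffeo hs) i
  simp only [Fin.sum_univ_succ, transversal_zero_apply, transversal_succ_apply, mul_zero,
    zero_mul, zero_add, Finset.sum_const_zero] at this
  rw [← this]
  refine Finset.sum_congr rfl fun a _ => Finset.sum_congr rfl fun b _ => ?_
  ring

lemma christoffel_zero_zero (hσ : IsFermiCoordinates h γ e U σ)
    (hγ : IsGeodesicOn h γ Set.univ) (i : Fin (d + 1)) (t : ℝ) :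
    christoffel (metricComp h σ) i 0 0 (axis t) = 0 := by
  rw [hσ.curve_eq] at hγ
  have := christoffel_of_geodesic_line h hγ (Set.mem_univ t) (hσ.localDiffeo (hσ.line_mem t)) i
  rw [zero_add, ← axis_eq] at this
  simpa [basisVec, Pi.single_apply] using this

/-- `e_j(t)` is the initial velocity of a curve that `φ` straightens to a coordinate line. The frame
thus has constant components. -/
lemma mfderiv_chart_frame (hσ : IsFermiCoordinates h γ e U σ)
    {φ : OpenPartialHomeomorph N (Coord d)}
    (hφ : φ ∈ IsManifold.maximalAtlas (𝓡 (d + 1)) ∞ N) (hEq : Set.EqOn σ φ.symm φ.target)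
    {t : ℝ} (ht : axis t ∈ φ.target) (j : Fin d) :
    mfderiv (𝓡 (d + 1)) (𝓡 (d + 1)) φ (γ t) (e j.succ t) = transversal (Pi.single j 1) := by
  set w : Coord d := transversal (Pi.single j 1) with hw
  set c : ℝ → N := fun s => σ (axis t + s • w) with hc
  have h0 : axis t + (0 : ℝ) • w ∈ φ.target := by simpa using ht
  have h0U : axis t + (0 : ℝ) • w ∈ U := by simpa using hσ.axis_mem t
  have hcd : MDifferentiableAt 𝓘(ℝ, ℝ) (𝓡 (d + 1)) c 0 := by
    have hopen : IsOpen {s : ℝ | axis t + s • w ∈ U} :=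
      hσ.isOpen.preimage (continuous_const.add (continuous_id.smul continuous_const))
    exact ((hσ.geodesic t (Pi.single j 1)).1.contMDiffAt
      (hopen.mem_nhds h0U)).mdifferentiableAt (by simp)
  have hφd : MDifferentiableAt (𝓡 (d + 1)) (𝓡 (d + 1)) φ (c 0) :=
    (contMDiffAt_of_mem_maximalAtlas hφ (chart_mem_source hEq h0).1).mdifferentiableAt (by simp)
  -- The two vectors of `initial` have different expressions as base points; applying `dφ` on the
  -- total space yields an equality in the fixed space `Coord d`.
  have h1 := congrArg (fun p : TangentBundle (𝓡 (d + 1)) N =>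
    (mfderiv (𝓡 (d + 1)) (𝓡 (d + 1)) φ p.1 p.2 : Coord d)) (hσ.initial t (Pi.single j 1))
  have hsum : ∑ k : Fin d, (Pi.single j 1 : Fin d → ℝ) k • e k.succ t = e j.succ t := by
    rw [Finset.sum_eq_single j (fun k _ hk => by rw [Pi.single_eq_of_ne hk, zero_smul]) (by simp)]
    simp
  simp only [hsum] at h1
  refine h1.symm.trans ?_
  have h2 : mfderiv (𝓡 (d + 1)) (𝓡 (d + 1)) φ (c 0) (mfderiv 𝓘(ℝ, ℝ) (𝓡 (d + 1)) c 0 (1 : ℝ))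
      = mfderiv 𝓘(ℝ, ℝ) (𝓡 (d + 1)) (φ ∘ c) 0 (1 : ℝ) := by
    rw [mfderiv_comp 0 hφd hcd]
    rfl
  refine h2.trans ?_
  have h3 : φ ∘ c =ᶠ[nhds 0] fun s => axis t + s • w := eventually_chart_line hEq h0
  have h4 : HasDerivAt (φ ∘ c) w 0 := (hasDerivAt_line (axis t) w 0).congr_of_eventuallyEq h3
  rw [mfderiv_eq_fderiv, h4.hasFDerivAt.fderiv]
  exact one_smul ℝ w

lemma deriv_chart_curve (hσ : IsFermiCoordinates h γ e U σ)
    {φ : OpenPartialHomeomorph N (Coord d)} (hEq : Set.EqOn σ φ.symm φ.target) {t : ℝ}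
    (ht : axis t ∈ φ.target) (k : Fin (d + 1)) :
    deriv (fun s => φ (γ s) k) t = (basisVec 0 : Coord d) k := by
  have hline : ∀ᶠ s in nhds t, φ (γ s) = 0 + s • basisVec 0 := by
    have := eventually_chart_line hEq (q := 0) (v := basisVec 0) (t := t)
      (by rw [zero_add, ← axis_eq]; exact ht)
    filter_upwards [this] with s hs
    rw [← hs, zero_add, ← axis_eq, hσ.apply_axis]
  exact (eventually_deriv_coord_of_eq_line hline k).self_of_nhds

/-- For a field with constant components along `γ' = ∂_0`, the parallel transport equation retains
only the term `Γ^i_{0j}`. -/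
lemma christoffel_zero_succ (hσ : IsFermiCoordinates h γ e U σ) (he : IsFermiFrame h γ e)
    (i : Fin (d + 1)) (j : Fin d) (t : ℝ) :
    christoffel (metricComp h σ) i 0 j.succ (axis t) = 0 := by
  obtain ⟨φ, hφ, hx, hEq⟩ := exists_chart_of_isLocalDiffeomorphAt (hσ.localDiffeo (hσ.axis_mem t))
  obtain ⟨hs, hv⟩ := chart_mem_source hEq hx
  rw [hσ.apply_axis] at hs hv
  have hd := hσ.deriv_chart_curve hEq hx
  have hframe : ∀ᶠ s in nhds t, mfderiv (𝓡 (d + 1)) (𝓡 (d + 1)) φ (γ s) (e j.succ s)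
      = transversal (Pi.single j 1) := by
    filter_upwards [(hasDerivAt_axis t).continuousAt.preimage_mem_nhds
      (φ.open_target.mem_nhds hx)] with s hs
    exact hσ.mfderiv_chart_frame hφ hEq hs j
  have h1 := he.parallel j φ hφ t hs i
  have h2 := h1.unique ((hasDerivAt_const t ((transversal (Pi.single j 1) : Coord d) i)
    ).congr_of_eventuallyEq (by
      filter_upwards [hframe] with s hs
      rw [hs]))
  simp only [hframe.self_of_nhds, hd, hv,
    ← eqOn_christoffel φ.open_target (eqOn_metricComp h φ.open_target hEq) _ _ _ hx] at h2
  simpa [Fin.sum_univ_succ, basisVec, Pi.single_apply, transversal_zero_apply,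
    transversal_succ_apply] using h2

lemma christoffel_axis (hσ : IsFermiCoordinates h γ e U σ) (hγ : IsGeodesicOn h γ Set.univ)
    (he : IsFermiFrame h γ e) (i j k : Fin (d + 1)) (t : ℝ) :
    christoffel (metricComp h σ) i j k (axis t) = 0 := by
  have hsym := christoffel_symm (metricComp_symm h σ) i
  have hquad : ∀ y : Fin d → ℝ, ∑ a : Fin d, ∑ b : Fin d, y a * (y b *
      christoffel (metricComp h σ) i a.succ b.succ (axis t)) = 0 := fun y => by
    have := hσ.christoffel_radial i t y (s := 0) (by simpa using hσ.axis_mem t)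
    simpa using this
  have hdiag : ∀ a : Fin d, christoffel (metricComp h σ) i a.succ a.succ (axis t) = 0 := fun a => by
    simpa [Pi.single_apply] using hquad (Pi.single a 1)
  -- Polarization of the quadratic form, using the symmetry of `Γ` in its lower indices.
  have hss : ∀ a b : Fin d, christoffel (metricComp h σ) i a.succ b.succ (axis t) = 0 := by
    intro a b
    have := hquad (Pi.single a 1 + Pi.single b 1)
    simp [Pi.single_apply, add_mul, Finset.sum_add_distrib, hdiag] at this
    rw [hsym b.succ] at this
    linarith
  refine Fin.cases ?_ (fun a => ?_) j <;> refine Fin.cases ?_ (fun b => ?_) k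
  · exact hσ.christoffel_zero_zero hγ i t
  · exact hσ.christoffel_zero_succ he i b t
  · rw [hsym]; exact hσ.christoffel_zero_succ he i a t
  · exact hss a b

lemma covDeriv_axis (hσ : IsFermiCoordinates h γ e U σ) (hsymm : IsLocallySymmetricAlong h γ)
    (n : ℕ) (i : Fin (d + 1)) (J : Fin (3 + n) → Fin (d + 1)) (t : ℝ) :
    covDeriv (metricComp h σ) (iterCovRiemann (metricComp h σ) n) i
      (Fin.cons 0 J : Fin (3 + n + 1) → Fin (d + 1)) (axis t) = 0 := by
  obtain ⟨φ, hφ, hx, hEq⟩ := exists_chart_of_isLocalDiffeomorphAt (hσ.localDiffeo (hσ.axis_mem t))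
  obtain ⟨hs, hv⟩ := chart_mem_source hEq hx
  rw [hσ.apply_axis] at hs hv
  have hd := hσ.deriv_chart_curve hEq hx
  have h1 := hsymm n t φ hφ hs i J
  have hg := eqOn_metricComp h φ.open_target hEq
  simp only [hd, hv, ← eqOn_covDeriv φ.open_target hg
    (fun i J => eqOn_iterCovRiemann φ.open_target hg n i J) i _ hx] at h1
  simpa [basisVec, Pi.single_apply] using h1

end IsFermiCoordinates

end FermiCoord

/-! ### The main theorem -/

theorem mainTheorem4 {d : ℕ} {N : Type*} [TopologicalSpace N]
    [ChartedSpace (FermiCoord.Coord d) N] [IsManifold (𝓡 (d + 1)) ∞ N]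
    (h : FermiCoord.Metric d N)
    (γ : ℝ → N) (hγ : FermiCoord.IsGeodesicOn h γ Set.univ)
    (hsymm : FermiCoord.IsLocallySymmetricAlong h γ)
    (e : Fin (d + 1) → (t : ℝ) → TangentSpace (𝓡 (d + 1)) (γ t))
    (he : FermiCoord.IsFermiFrame h γ e)
    (U : Set (FermiCoord.Coord d)) (σ : FermiCoord.Coord d → N)
    (hσ : FermiCoord.IsFermiCoordinates h γ e U σ) :
    -- the Christoffel symbols and the curvature components are smooth on the coordinate domain
    (∀ i j k, ContDiffOn ℝ ∞ (FermiCoord.christoffel (FermiCoord.metricComp h σ) k i j) U) ∧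
    (∀ i j k l, ContDiffOn ℝ ∞ (FermiCoord.riemann (FermiCoord.metricComp h σ) i j k l) U) ∧
    -- the derivatives `∂_1 ∂^I` of them vanish along `γ`
    (∀ (I : List (Fin (d + 1))) (i j k : Fin (d + 1)) (t : ℝ),
      FermiCoord.pd 0 (FermiCoord.pdIter I
        (FermiCoord.christoffel (FermiCoord.metricComp h σ) k i j)) (FermiCoord.axis t) = 0) ∧
    (∀ (I : List (Fin (d + 1))) (i j k l : Fin (d + 1)) (t : ℝ),
      FermiCoord.pd 0 (FermiCoord.pdIter I
        (FermiCoord.riemann (FermiCoord.metricComp h σ) i j k l)) (FermiCoord.axis t) = 0) ∧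
    -- all their Taylor coefficients are constant along `γ`
    (∀ (I : List (Fin (d + 1))) (i j k : Fin (d + 1)) (s t : ℝ),
      FermiCoord.pdIter I (FermiCoord.christoffel (FermiCoord.metricComp h σ) k i j)
          (FermiCoord.axis s)
        = FermiCoord.pdIter I (FermiCoord.christoffel (FermiCoord.metricComp h σ) k i j)
          (FermiCoord.axis t)) ∧
    (∀ (I : List (Fin (d + 1))) (i j k l : Fin (d + 1)) (s t : ℝ),
      FermiCoord.pdIter I (FermiCoord.riemann (FermiCoord.metricComp h σ) i j k l)
          (FermiCoord.axis s)
        = FermiCoord.pdIter I (FermiCoord.riemann (FermiCoord.metricComp h σ) i j k l)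
          (FermiCoord.axis t)) := by
  have hU := hσ.isOpen
  have hax := hσ.axis_mem
  have hΓ := hσ.contDiffOn_christoffel
  have hR : ∀ i j k l, ContDiffOn ℝ ∞
      (FermiCoord.riemann (FermiCoord.metricComp h σ) i j k l) U :=
    FermiCoord.contDiffOn_riemann hU hΓ
  have key := FermiCoord.axisConst_christoffel_and_iterCovRiemann hU hax hΓ
    (FermiCoord.metricComp_symm h σ) (hσ.christoffel_axis hγ he)
    (fun i x hx => by
      have := hσ.christoffel_radial i (x 0) (fun a => x a.succ) (s := 1)
        (by rwa [one_smul, FermiCoord.axis_add_transversal])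
      rwa [one_smul, FermiCoord.axis_add_transversal] at this)
    (hσ.covDeriv_axis hsymm)
  have hΓ' : ∀ (I : List (Fin (d + 1))) (i j k : Fin (d + 1)) (t : ℝ),
      FermiCoord.pd 0 (FermiCoord.pdIter I
        (FermiCoord.christoffel (FermiCoord.metricComp h σ) k i j)) (FermiCoord.axis t) = 0 :=
    fun I i j k => FermiCoord.AxisConst.pd_pdIter I fun m => (key m).1 k i j
  have hR' : ∀ (I : List (Fin (d + 1))) (i j k l : Fin (d + 1)) (t : ℝ),
      FermiCoord.pd 0 (FermiCoord.pdIter I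
        (FermiCoord.riemann (FermiCoord.metricComp h σ) i j k l)) (FermiCoord.axis t) = 0 :=
    fun I i j k l => FermiCoord.AxisConst.pd_pdIter I fun m => (key m).2 0 i ![j, k, l]
  exact ⟨fun i j k => hΓ k i j, hR, hΓ', hR',
    fun I i j k => FermiCoord.axis_const_of_pd_zero hU hax
      (FermiCoord.contDiffOn_pdIter hU (hΓ k i j) I) (hΓ' I i j k),
    fun I i j k l => FermiCoord.axis_const_of_pd_zero hU hax
      (FermiCoord.contDiffOn_pdIter hU (hR i j k l) I) (hR' I i j k l)⟩
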